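/- Work on the unit sphere $S^2\subset\mathbb R^3$ with the geodesic distance $|ab|\in[0,\pi]$. A disk of radius $\rho\in(0,\frac{\pi}{2}]$ is the set of points at distance at most $\rho$ from a fixed point (its center); a hemisphere is a disk of radius $\frac{\pi}{2}$. A convex body is a closed set $C\subset S^2$ with non-empty interior that contains no pair of antipodes and contains, with any two points, the shorter great-circle arc joining them. A hemisphere $K$ supports $C$ if $C\subset K$ and the boundaries of $C$ and $K$ have a common point. If $K,K'$ are different and not opposite hemispheres, the thickness of the lune $K\cap K'$ is the distance between the centers of the two semicircles bounding it. For a hemisphere $K$ supporting $C$, let $\mathrm{width}_K(C)$ be the minimum of the thicknesses of the lunes $K\cap K'$ over all hemispheres $K'$ supporting $C$. The thickness $\Delta(C)$ is the smallest of the numbers $\mathrm{width}_K(C)$, and $C$ is of constant width if all these numbers are equal (then they equal $\Delta(C)$). Theorem. Let $W\subset S^2$ be a convex body of constant width with $\Delta(W)\ge\frac{\pi}{2}$. Then $W$ is contained in a disk of radius $$\Delta(W)+\arcsin\left(\frac{2\sqrt3}{3}\cdot\cos\frac{\Delta(W)}{2}\right)-\frac{\pi}{2}.$$ -/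

import Mathlib

namespace SphericalBody

/-- The unit sphere `S²` of Euclidean 3-space. Its topology (used for `interior`, `frontier`,
`IsClosed` below) is the one induced from the ambient space. -/
abbrev S2 : Type := Metric.sphere (0 : EuclideanSpace ℝ (Fin 3)) 1

/-- The spherical (geodesic) distance `|ab|`, with values in `[0, π]`: the length of the shorter
part of a great circle through `a` and `b`; it is `0` if `a = b` and `π` for antipodes. -/
noncomputable def sdist (a b : S2) : ℝ :=
  InnerProductGeometry.angle (a : EuclideanSpace ℝ (Fin 3)) (b : EuclideanSpace ℝ (Fin 3))

/-- The arc `ab` (the shorter part of the great circle through `a` and `b`, which are not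
antipodes): the points of the sphere that are nonnegative combinations of `a` and `b`. -/
def arc (a b : S2) : Set S2 :=
  {x | ∃ s t : ℝ, 0 ≤ s ∧ 0 ≤ t ∧
    (x : EuclideanSpace ℝ (Fin 3)) =
      s • (a : EuclideanSpace ℝ (Fin 3)) + t • (b : EuclideanSpace ℝ (Fin 3))}

/-- The spherical ball `B_ρ(c)`. -/
def ball (c : S2) (ρ : ℝ) : Set S2 := {x | sdist c x ≤ ρ}

/-- `D` is a disk of radius `ρ`, where a radius is a number in `(0, π/2]`. -/
def IsDisk (D : Set S2) (ρ : ℝ) : Prop :=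
  0 < ρ ∧ ρ ≤ Real.pi / 2 ∧ ∃ c : S2, D = ball c ρ

/-- The hemisphere `H(m)` with center `m`. -/
noncomputable def hemisphere (m : S2) : Set S2 := ball m (Real.pi / 2)

/-- Spherical convexity: no pair of antipodes, and closed under taking arcs. -/
def IsConvex (C : Set S2) : Prop :=
  (∀ a ∈ C, -a ∉ C) ∧ ∀ a ∈ C, ∀ b ∈ C, arc a b ⊆ C

/-- A convex body: a closed convex set with non-empty interior. -/
def IsConvexBody (C : Set S2) : Prop :=
  IsClosed C ∧ IsConvex C ∧ (interior C).Nonempty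

/-- The hemisphere `H(k)` supports `C`: it contains `C` and the boundaries meet. -/
def Supports (k : S2) (C : Set S2) : Prop :=
  C ⊆ hemisphere k ∧ (frontier C ∩ frontier (hemisphere k)).Nonempty

/-- For `G = H(g)` and `H = H(h)`, the semicircle `G/H` bounding the lune `G ∩ H`: the part of the
boundary of `G` that lies in `H`. -/
def semicircle (g h : S2) : Set S2 := frontier (hemisphere g) ∩ hemisphere h

/-- `c` is the center of the semicircle `G/H`: the point of the great circle `bd G` such that
`G/H` consists of the points of `bd G` at distance at most `π/2` from `c`. -/
def IsSemicircleCenter (g h c : S2) : Prop :=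
  c ∈ frontier (hemisphere g) ∧
    semicircle g h = {x | x ∈ frontier (hemisphere g) ∧ sdist c x ≤ Real.pi / 2}

/-- `H(g) ∩ H(h)` is a lune (the hemispheres are different and not opposite), and `t` is its
thickness: the distance between the centers of the two semicircles that bound it. -/
def IsLuneThickness (g h : S2) (t : ℝ) : Prop :=
  h ≠ g ∧ h ≠ -g ∧
    ∃ c c' : S2, IsSemicircleCenter g h c ∧ IsSemicircleCenter h g c' ∧ t = sdist c c'

/-- `width_K(C)` for `K = H(k)`: the smallest thickness of a lune `K ∩ K'`, over the hemispheres
`K'` supporting `C`. -/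
noncomputable def width (k : S2) (C : Set S2) : ℝ :=
  sInf {t | ∃ k' : S2, Supports k' C ∧ IsLuneThickness k k' t}

/-- The thickness `Δ(C)`: the smallest width of `C`, over the hemispheres supporting `C`. -/
noncomputable def thickness (C : Set S2) : ℝ :=
  sInf {w | ∃ k : S2, Supports k C ∧ w = width k C}

/-- `W` is a body of constant width: a convex body all of whose widths are equal. -/
def IsOfConstantWidth (W : Set S2) : Prop :=
  IsConvexBody W ∧ ∀ k k' : S2, Supports k W → Supports k' W → width k W = width k' W

end SphericalBody

/-!
Let `d = π - Δ(W) ≤ π / 2`. Two hemispheres containing `W` have centers at distance at most `d`: a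
farthest pair of such centers belongs to supporting hemispheres, and these form a lune of thickness
at least `Δ(W)`. By Jung's theorem on the sphere, the centers lie in a ball of radius
`r = arcsin (2 / √3 * sin (d / 2))` about a point `c`, and `W ⊆ H(c)`. Let `y` be the point of `W`
farthest from `c`. The hemisphere `H(k)` touching the ball of radius `|cy|` about `c` at `y`
supports `W`, and `|ck| = π / 2 - |cy|`. Since the width for `H(k)` is `Δ(W)`, some `H(b)` that
contains `W` has `|kb| ≥ d`, so `d ≤ |kc| + |cb| ≤ π / 2 - |cy| + r`, that is,
`|cy| ≤ Δ(W) + r - π / 2`.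
-/

namespace SphericalBody

open Filter InnerProductGeometry Module Real Set
open scoped InnerProductSpace Topology

section Jung

lemma isCompact_convexHull {E : Type*} [AddCommGroup E] [Module ℝ E] [TopologicalSpace E]
    [ContinuousAdd E] [ContinuousSMul ℝ E] [FiniteDimensional ℝ E] {s : Set E}
    (hs : IsCompact s) : IsCompact (convexHull ℝ s) := by
  let combination (m : ℕ) (p : (Fin m → ℝ) × (Fin m → E)) : E := ∑ i, p.1 i • p.2 i
  have caratheodory : convexHull ℝ s = ⋃ m ∈ Finset.range (finrank ℝ E + 2),
      combination m '' (stdSimplex ℝ (Fin m) ×ˢ univ.pi fun _ => s) := by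
    refine Subset.antisymm (fun x hx => ?_) (iUnion₂_subset fun m _ => ?_)
    · obtain ⟨ι, _, z, w, hzs, hz, hw, hw1, rfl⟩ := eq_pos_convex_span_of_mem_convexHull hx
      have hcard : Fintype.card ι ≤ finrank ℝ E + 1 :=
        hz.card_le_finrank_succ.trans (Nat.add_le_add_right (Submodule.finrank_le _) 1)
      let e := (Fintype.equivFin ι).symm
      refine mem_biUnion (Finset.mem_coe.2 (Finset.mem_range.2 (Nat.lt_succ_of_le hcard)))
        ⟨(w ∘ e, z ∘ e), ⟨⟨fun i => (hw _).le, ?_⟩, fun i _ => hzs (mem_range_self _)⟩, ?_⟩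
      · rw [← hw1]
        exact e.sum_comp w
      · exact e.sum_comp fun i => w i • z i
    · rintro _ ⟨⟨w, z⟩, ⟨hw, hz⟩, rfl⟩
      exact (convex_convexHull ℝ s).sum_mem (fun i _ => hw.1 i) hw.2
        fun i _ => subset_convexHull ℝ s (hz i (mem_univ i))
  rw [caratheodory]
  exact Finset.isCompact_biUnion _ fun m _ =>
    ((isCompact_stdSimplex ℝ _).prod (isCompact_univ_pi fun _ => hs)).image (by fun_prop)

lemma linearIndependent_of_affineIndependent_of_apply_eq {k V ι : Type*} [Field k]
    [AddCommGroup V] [Module k V] {z : ι → V} (hz : AffineIndependent k z) (f : V →ₗ[k] k) {a : k}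
    (ha : a ≠ 0) (hf : ∀ i, f (z i) = a) : LinearIndependent k z := by
  rw [linearIndependent_iff']
  intro s g hg
  refine affineIndependent_iff.1 hz s g ?_ hg
  have happly : (∑ i ∈ s, g i) * a = 0 := by
    simpa only [map_sum, map_smul, hf, smul_eq_mul, ← Finset.sum_mul, map_zero] using congrArg f hg
  exact (mul_eq_zero.1 happly).resolve_right ha

lemma eq_of_le_of_sum_mul_eq {ι : Type*} [Fintype ι] {w f : ι → ℝ} {a : ℝ} (hw : ∀ i, 0 < w i)
    (hw1 : ∑ i, w i = 1) (hf : ∀ i, a ≤ f i) (hsum : ∑ i, w i * f i = a) (i : ι) : f i = a := by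
  have hzero : ∑ i, w i * (f i - a) = 0 := by
    simp only [mul_sub, Finset.sum_sub_distrib, ← Finset.sum_mul, hw1, hsum, one_mul, sub_self]
  have hterm := (Finset.sum_eq_zero_iff_of_nonneg fun j _ =>
    mul_nonneg (hw j).le (sub_nonneg.2 (hf j))).1 hzero i (Finset.mem_univ i)
  exact sub_eq_zero.1 ((mul_eq_zero.1 hterm).resolve_left (hw i).ne')

lemma inv_card_le_sum_sq {ι : Type*} [Fintype ι] {w : ι → ℝ} (hw1 : ∑ i, w i = 1) :
    (Fintype.card ι : ℝ)⁻¹ ≤ ∑ i, w i ^ 2 := by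
  have hcauchy : (1 : ℝ) ≤ Fintype.card ι * ∑ i, w i ^ 2 := by
    simpa only [hw1, one_pow, Finset.card_univ] using
      sq_sum_le_card_mul_sum_sq (s := Finset.univ) (f := w)
  have hcard : (0 : ℝ) < Fintype.card ι := (Nat.cast_nonneg _).lt_of_ne' fun h => by
    norm_num [h] at hcauchy
  exact (inv_le_iff_one_le_mul₀' hcard).2 hcauchy

variable {E : Type*} [NormedAddCommGroup E] [InnerProductSpace ℝ E]

lemma add_mul_sum_sq_le_norm_sum_smul_sq {ι : Type*} [Fintype ι] {w : ι → ℝ} {z : ι → E} {κ : ℝ}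
    (hw : ∀ i, 0 ≤ w i) (hw1 : ∑ i, w i = 1) (hunit : ∀ i, ‖z i‖ = 1)
    (hκ : ∀ i j, κ ≤ ⟪z i, z j⟫_ℝ) :
    κ + (1 - κ) * ∑ i, w i ^ 2 ≤ ‖∑ i, w i • z i‖ ^ 2 := by
  have hgram : ‖∑ i, w i • z i‖ ^ 2 = ∑ i, ∑ j, w i * w j * ⟪z i, z j⟫_ℝ := by
    simp only [← real_inner_self_eq_norm_sq, sum_inner, inner_sum, inner_smul_left,
      inner_smul_right, RCLike.conj_to_real, Finset.mul_sum, mul_assoc]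
    exact Finset.sum_congr rfl fun i _ => Finset.sum_congr rfl fun j _ => by
      rw [real_inner_comm, mul_left_comm]
  have hmean : ∑ i, ∑ j, w i * w j * κ = κ := by
    simp only [← Finset.sum_mul, ← Finset.mul_sum, hw1, mul_one, one_mul]
  have hdiag : (1 - κ) * ∑ i, w i ^ 2 ≤ ∑ i, ∑ j, w i * w j * (⟪z i, z j⟫_ℝ - κ) := by
    rw [Finset.mul_sum]
    refine Finset.sum_le_sum fun i _ => ?_
    calc (1 - κ) * w i ^ 2 = w i * w i * (⟪z i, z i⟫_ℝ - κ) := by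
          rw [real_inner_self_eq_norm_sq, hunit]; ring
      _ ≤ _ := Finset.single_le_sum (f := fun j => w i * w j * (⟪z i, z j⟫_ℝ - κ))
          (fun j _ => mul_nonneg (mul_nonneg (hw i) (hw j)) (sub_nonneg.2 (hκ i j)))
          (Finset.mem_univ i)
  simp only [mul_sub, Finset.sum_sub_distrib, ← hgram, hmean] at hdiag
  linarith

lemma exists_mem_convexHull_forall_norm_sq_le_inner [FiniteDimensional ℝ E] {s : Set E}
    (hs : IsCompact s) (hne : s.Nonempty) :
    ∃ h ∈ convexHull ℝ s, ∀ x ∈ s, ‖h‖ ^ 2 ≤ ⟪h, x⟫_ℝ := by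
  obtain ⟨h, hh, hmin⟩ := exists_norm_eq_iInf_of_complete_convex
    (hne.mono (subset_convexHull ℝ s)) (isCompact_convexHull hs).isComplete
    (convex_convexHull ℝ s) 0
  rw [norm_eq_iInf_iff_real_inner_le_zero (convex_convexHull ℝ s) hh] at hmin
  refine ⟨h, hh, fun x hx => ?_⟩
  have hle := hmin x (subset_convexHull ℝ s hx)
  rw [zero_sub, inner_neg_left, inner_sub_right, real_inner_self_eq_norm_sq] at hle
  linarith

/- The point `h` of the convex hull nearest to the origin lies on a simplex whose vertices are all
in the hyperplane `⟪h, x⟫ = ‖h‖ ^ 2`, so there are at most `dim E` of them. -/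
theorem exists_mem_convexHull_le_norm_sq [FiniteDimensional ℝ E] {s : Set E} (hs : IsCompact s)
    (hne : s.Nonempty) (hunit : ∀ x ∈ s, ‖x‖ = 1) {κ : ℝ} (hκ0 : 0 ≤ κ)
    (hκ : ∀ x ∈ s, ∀ y ∈ s, κ ≤ ⟪x, y⟫_ℝ) :
    ∃ h ∈ convexHull ℝ s, κ + (1 - κ) / finrank ℝ E ≤ ‖h‖ ^ 2 ∧
      ∀ x ∈ s, ‖h‖ ^ 2 ≤ ⟪h, x⟫_ℝ := by
  obtain ⟨h, hh, hle⟩ := exists_mem_convexHull_forall_norm_sq_le_inner hs hne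
  refine ⟨h, hh, ?_, hle⟩
  obtain ⟨ι, _, z, w, hzs, hz, hw, hw1, hwz⟩ := eq_pos_convex_span_of_mem_convexHull hh
  replace hzs (i : ι) : z i ∈ s := hzs (mem_range_self i)
  have hκ1 : κ ≤ 1 := by
    obtain ⟨x, hx⟩ := hne
    simpa [real_inner_self_eq_norm_sq, hunit x hx] using hκ x hx x hx
  have hgram : κ + (1 - κ) * ∑ i, w i ^ 2 ≤ ‖h‖ ^ 2 := hwz ▸
    add_mul_sum_sq_le_norm_sum_smul_sq (fun i => (hw i).le) hw1 (fun i => hunit _ (hzs i))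
      fun i j => hκ _ (hzs i) _ (hzs j)
  have hι : Nonempty ι := by
    by_contra hι
    simp [not_nonempty_iff.1 hι] at hw1
  have hsq : 0 < ∑ i, w i ^ 2 := Finset.sum_pos (fun i _ => pow_pos (hw i) 2) Finset.univ_nonempty
  have hpos : 0 < ‖h‖ ^ 2 := by
    refine lt_of_lt_of_le ?_ hgram
    rcases hκ0.eq_or_lt with rfl | hκ0
    · simpa using hsq
    · exact add_pos_of_pos_of_nonneg hκ0 (mul_nonneg (sub_nonneg.2 hκ1) hsq.le)
  have hcontact : ∀ i, ⟪h, z i⟫_ℝ = ‖h‖ ^ 2 := by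
    refine eq_of_le_of_sum_mul_eq hw hw1 (fun i => hle _ (hzs i)) ?_
    simp only [← real_inner_smul_right, ← inner_sum, hwz, real_inner_self_eq_norm_sq]
  have hcard : Fintype.card ι ≤ finrank ℝ E :=
    (linearIndependent_of_affineIndependent_of_apply_eq hz (innerₗ E h) hpos.ne'
      hcontact).fintype_card_le_finrank
  have hrank : (finrank ℝ E : ℝ)⁻¹ ≤ ∑ i, w i ^ 2 :=
    (inv_anti₀ (Nat.cast_pos.2 Fintype.card_pos) (Nat.cast_le.2 hcard)).trans
      (inv_card_le_sum_sq hw1)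
  calc κ + (1 - κ) / finrank ℝ E ≤ κ + (1 - κ) * ∑ i, w i ^ 2 := by
        rw [div_eq_mul_inv]
        gcongr
    _ ≤ ‖h‖ ^ 2 := hgram

end Jung

local notation "E3" => EuclideanSpace ℝ (Fin 3)

section Sphere

variable {g h m x y : S2}

lemma inner_coe_self (x : S2) : ⟪(x : E3), x⟫_ℝ = 1 := by
  rw [real_inner_self_eq_norm_sq, norm_eq_of_mem_sphere, one_pow]

lemma sdist_eq_arccos (x y : S2) : sdist x y = arccos ⟪(x : E3), y⟫_ℝ := by
  simp only [sdist, angle, norm_eq_of_mem_sphere, mul_one, div_one]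

lemma cos_sdist (x y : S2) : cos (sdist x y) = ⟪(x : E3), y⟫_ℝ :=
  (inner_eq_cos_angle_of_norm_eq_one (norm_eq_of_mem_sphere x) (norm_eq_of_mem_sphere y)).symm

lemma inner_coe_le_one (x y : S2) : ⟪(x : E3), y⟫_ℝ ≤ 1 := cos_sdist x y ▸ cos_le_one _

lemma inner_coe_lt_one (hne : x ≠ y) : ⟪(x : E3), y⟫_ℝ < 1 :=
  (inner_lt_one_iff_real_of_norm_eq_one (norm_eq_of_mem_sphere x) (norm_eq_of_mem_sphere y)).2
    (Subtype.coe_injective.ne hne)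

lemma sdist_nonneg (x y : S2) : 0 ≤ sdist x y := angle_nonneg _ _

lemma sdist_le_pi (x y : S2) : sdist x y ≤ π := angle_le_pi _ _

lemma sdist_le_iff {d : ℝ} (hd : d ∈ Icc 0 π) : sdist x y ≤ d ↔ cos d ≤ ⟪(x : E3), y⟫_ℝ := by
  rw [← cos_sdist, strictAntiOn_cos.le_iff_ge hd ⟨sdist_nonneg x y, sdist_le_pi x y⟩]

lemma sdist_le_sdist_iff {x' y' : S2} :
    sdist x y ≤ sdist x' y' ↔ ⟪(x' : E3), y'⟫_ℝ ≤ ⟪(x : E3), y⟫_ℝ := by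
  rw [sdist_le_iff ⟨sdist_nonneg x' y', sdist_le_pi x' y'⟩, cos_sdist]

lemma sdist_comm (x y : S2) : sdist x y = sdist y x := angle_comm _ _

lemma sdist_triangle (x y z : S2) : sdist x z ≤ sdist x y + sdist y z :=
  angle_le_angle_add_angle _ _ _

lemma sdist_self (x : S2) : sdist x x = 0 := angle_self (ne_zero_of_mem_unit_sphere x)

lemma sdist_eq_zero_iff : sdist x y = 0 ↔ x = y := by
  refine ⟨fun hxy => Subtype.ext (eq_of_angle_eq_zero_of_norm_eq hxy ?_), ?_⟩
  · rw [norm_eq_of_mem_sphere, norm_eq_of_mem_sphere]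
  · rintro rfl
    exact sdist_self x

lemma sdist_neg_right (x y : S2) : sdist x (-y) = π - sdist x y :=
  angle_neg_right _ _

lemma sdist_eq_pi_iff : sdist x y = π ↔ y = -x := by
  rw [← neg_eq_iff_eq_neg, eq_comm (a := -y), ← sdist_eq_zero_iff, sdist_neg_right, sub_eq_zero,
    eq_comm]

lemma continuous_sdist : Continuous fun p : S2 × S2 => sdist p.1 p.2 := by
  simp only [sdist_eq_arccos]
  fun_prop

lemma exists_farthest_from (c : S2) {A : Set S2} (hA : IsClosed A) (hne : A.Nonempty) :
    ∃ y ∈ A, ∀ z ∈ A, sdist c z ≤ sdist c y :=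
  hA.isCompact.exists_isMaxOn hne (continuous_sdist.comp (.prodMk_right c)).continuousOn

lemma exists_farthest_pair {A : Set S2} (hA : IsClosed A) (hne : A.Nonempty) :
    ∃ a ∈ A, ∃ b ∈ A, ∀ x ∈ A, ∀ y ∈ A, sdist x y ≤ sdist a b := by
  obtain ⟨⟨a, b⟩, ⟨ha, hb⟩, hmax⟩ := (hA.isCompact.prod hA.isCompact).exists_isMaxOn
    (hne.prod hne) continuous_sdist.continuousOn
  exact ⟨a, ha, b, hb, fun x hx y hy => isMaxOn_iff.1 hmax (x, y) ⟨hx, hy⟩⟩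

/-- The point of the sphere in the direction of a nonzero vector `v`. -/
noncomputable def direction (v : E3) (hv : v ≠ 0) : S2 :=
  ⟨NormedSpace.normalize v, by simp [NormedSpace.norm_normalize_eq_one_iff.2 hv]⟩

lemma inner_direction_left {v : E3} (hv : v ≠ 0) (y : E3) :
    ⟪(direction v hv : E3), y⟫_ℝ = ‖v‖⁻¹ * ⟪v, y⟫_ℝ :=
  real_inner_smul_left _ _ _

lemma inner_direction_nonneg_iff {v : E3} (hv : v ≠ 0) (y : E3) :
    0 ≤ ⟪(direction v hv : E3), y⟫_ℝ ↔ 0 ≤ ⟪v, y⟫_ℝ := by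
  rw [inner_direction_left, mul_nonneg_iff_of_pos_left (inv_pos.2 (norm_pos_iff.2 hv))]

lemma inner_direction_eq_zero_iff {v : E3} (hv : v ≠ 0) (y : E3) :
    ⟪(direction v hv : E3), y⟫_ℝ = 0 ↔ ⟪v, y⟫_ℝ = 0 := by
  rw [inner_direction_left, mul_eq_zero_iff_left (inv_ne_zero (norm_ne_zero_iff.2 hv))]

lemma sdist_direction_right (x : S2) {v : E3} (hv : v ≠ 0) :
    sdist x (direction v hv) = angle (x : E3) v :=
  angle_normalize_right _ _

lemma sdist_direction_direction {v w : E3} (hv : v ≠ 0) (hw : w ≠ 0) :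
    sdist (direction v hv) (direction w hw) = angle v w := by
  rw [sdist_direction_right]
  exact angle_normalize_left _ _

/-- The component of `h` orthogonal to `g`; its direction is the center of the semicircle `G/H`
bounding the lune `H(g) ∩ H(h)`. -/
noncomputable def orthComponent (g h : S2) : E3 := (h : E3) - ⟪(g : E3), h⟫_ℝ • (g : E3)

lemma inner_orthComponent_left (g h : S2) (x : E3) :
    ⟪orthComponent g h, x⟫_ℝ = ⟪(h : E3), x⟫_ℝ - ⟪(g : E3), h⟫_ℝ * ⟪(g : E3), x⟫_ℝ := by
  rw [orthComponent, inner_sub_left, real_inner_smul_left]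

lemma inner_orthComponent_self (g h : S2) : ⟪orthComponent g h, g⟫_ℝ = 0 := by
  rw [inner_orthComponent_left, inner_coe_self, real_inner_comm, mul_one, sub_self]

lemma inner_orthComponent_right (g h : S2) :
    ⟪orthComponent g h, h⟫_ℝ = ‖orthComponent g h‖ ^ 2 := by
  rw [← real_inner_self_eq_norm_sq]
  nth_rw 3 [orthComponent]
  rw [inner_sub_right, real_inner_smul_right, inner_orthComponent_self, mul_zero, sub_zero]

lemma norm_orthComponent (g h : S2) : ‖orthComponent g h‖ = sin (sdist g h) := by
  rw [← sq_eq_sq₀ (norm_nonneg _) (sin_nonneg_of_nonneg_of_le_pi (sdist_nonneg g h)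
    (sdist_le_pi g h)), ← inner_orthComponent_right, inner_orthComponent_left, inner_coe_self,
    sin_sq, cos_sdist, sq]

lemma orthComponent_ne_zero (hne : h ≠ g) (hne' : h ≠ -g) : orthComponent g h ≠ 0 := by
  rw [← norm_ne_zero_iff, norm_orthComponent]
  refine (sin_pos_of_pos_of_lt_pi ((sdist_nonneg g h).lt_of_ne' ?_)
    ((sdist_le_pi g h).lt_of_ne ?_)).ne'
  · exact fun hzero => hne (sdist_eq_zero_iff.1 hzero).symm
  · exact fun hpi => hne' (sdist_eq_pi_iff.1 hpi)

lemma angle_orthComponent_orthComponent (hne : h ≠ g) (hne' : h ≠ -g) :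
    angle (orthComponent g h) (orthComponent h g) = π - sdist g h := by
  have hsin : sin (sdist g h) ≠ 0 :=
    norm_orthComponent g h ▸ norm_ne_zero_iff.2 (orthComponent_ne_zero hne hne')
  have hinner : ⟪orthComponent g h, orthComponent h g⟫_ℝ
      = -cos (sdist g h) * (sin (sdist g h) * sin (sdist g h)) := by
    rw [← sq, sin_sq, cos_sdist, inner_orthComponent_left]
    simp only [orthComponent, inner_sub_right, real_inner_smul_right, inner_coe_self,
      real_inner_comm (g : E3) h]
    ring
  rw [angle, hinner, norm_orthComponent, norm_orthComponent, sdist_comm h g,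
    mul_div_cancel_right₀ _ (mul_ne_zero hsin hsin), arccos_neg,
    arccos_cos (sdist_nonneg g h) (sdist_le_pi g h)]

lemma sdist_le_pi_div_two_iff : sdist x y ≤ π / 2 ↔ 0 ≤ ⟪(x : E3), y⟫_ℝ := by
  rw [sdist_eq_arccos, arccos_le_pi_div_two]

lemma mem_hemisphere : x ∈ hemisphere m ↔ 0 ≤ ⟪(m : E3), x⟫_ℝ := sdist_le_pi_div_two_iff

lemma isClosed_hemisphere (m : S2) : IsClosed (hemisphere m) := by
  have heq : hemisphere m = {x : S2 | 0 ≤ ⟪(m : E3), x⟫_ℝ} := Set.ext fun _ => mem_hemisphere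
  rw [heq]
  exact isClosed_le continuous_const (by fun_prop)

lemma notMem_interior_hemisphere (hmx : ⟪(m : E3), x⟫_ℝ = 0) : x ∉ interior (hemisphere m) := by
  -- Otherwise `0` would be a local minimum of `⟪m, γ t⟫ = sin t` along a great circle `γ`.
  intro hx
  have hxm : ⟪(x : E3), m⟫_ℝ = 0 := by rwa [real_inner_comm]
  have hγ (t : ℝ) : cos t • (x : E3) + sin t • (m : E3) ∈ Metric.sphere (0 : E3) 1 := by
    rw [mem_sphere_zero_iff_norm, ← sq_eq_sq₀ (norm_nonneg _) zero_le_one, norm_add_sq_real,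
      norm_smul, norm_smul, real_inner_smul_left, real_inner_smul_right, hxm]
    simp
  let γ (t : ℝ) : S2 := ⟨_, hγ t⟩
  have hγ0 : γ 0 = x := Subtype.ext (by simp [γ])
  have hcont : Continuous γ := by fun_prop
  have hmin : IsLocalMin sin 0 := by
    filter_upwards [hcont.continuousAt (hγ0 ▸ mem_interior_iff_mem_nhds.1 hx :
      hemisphere m ∈ 𝓝 (γ 0))] with t ht
    have hinner : 0 ≤ ⟪(m : E3), γ t⟫_ℝ := mem_hemisphere.1 ht
    rw [sin_zero]
    simpa [γ, inner_add_right, real_inner_smul_right, hmx] using hinner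
  simpa using hmin.hasDerivAt_eq_zero (hasDerivAt_sin 0)

lemma mem_frontier_hemisphere : x ∈ frontier (hemisphere m) ↔ ⟪(m : E3), x⟫_ℝ = 0 := by
  have hopen : IsOpen {z : S2 | 0 < ⟪(m : E3), z⟫_ℝ} :=
    isOpen_lt continuous_const (by fun_prop)
  rw [(isClosed_hemisphere m).frontier_eq]
  refine ⟨fun ⟨hx, hx'⟩ => ?_, fun hx => ⟨mem_hemisphere.2 hx.ge, notMem_interior_hemisphere hx⟩⟩
  refine ((mem_hemisphere.1 hx).eq_or_lt).resolve_right (fun hpos => hx' ?_) |>.symm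
  exact interior_maximal (fun z hz => mem_hemisphere.2 (le_of_lt hz)) hopen hpos

end Sphere

section Lune

variable {c c' g h : S2} {t : ℝ}

lemma isSemicircleCenter_iff : IsSemicircleCenter g h c ↔ ⟪(g : E3), c⟫_ℝ = 0 ∧
    ∀ x : S2, ⟪(g : E3), x⟫_ℝ = 0 → (0 ≤ ⟪(h : E3), x⟫_ℝ ↔ 0 ≤ ⟪(c : E3), x⟫_ℝ) := by
  simp only [IsSemicircleCenter, semicircle, Set.ext_iff, mem_inter_iff, mem_ofPred_eq,
    mem_frontier_hemisphere, mem_hemisphere, sdist_le_pi_div_two_iff, and_congr_right_iff]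

lemma isSemicircleCenter_direction (hne : orthComponent g h ≠ 0) :
    IsSemicircleCenter g h (direction (orthComponent g h) hne) := by
  refine isSemicircleCenter_iff.2 ⟨?_, fun x hx => ?_⟩
  · rw [real_inner_comm, inner_direction_eq_zero_iff, inner_orthComponent_self]
  · rw [inner_direction_nonneg_iff, inner_orthComponent_left, hx, mul_zero, sub_zero]

lemma semicircleCenter_unique (hc : IsSemicircleCenter g h c) (hc' : IsSemicircleCenter g h c') :
    c = c' := by
  by_contra hne
  rw [isSemicircleCenter_iff] at hc hc'
  have hlt : ⟪(c : E3), c'⟫_ℝ < 1 := inner_coe_lt_one hne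
  have hv : (c : E3) - c' ≠ 0 := sub_ne_zero.2 (Subtype.coe_injective.ne hne)
  let x := direction _ hv
  have hgx : ⟪(g : E3), x⟫_ℝ = 0 := by
    rw [real_inner_comm, inner_direction_eq_zero_iff, real_inner_comm, inner_sub_right, hc.1, hc'.1,
      sub_zero]
  have hcx : 0 ≤ ⟪(c : E3), x⟫_ℝ := by
    rw [real_inner_comm, inner_direction_nonneg_iff, inner_sub_left, inner_coe_self,
      real_inner_comm]
    exact sub_nonneg.2 hlt.le
  have hcx' : 0 ≤ ⟪(c' : E3), x⟫_ℝ := (hc'.2 x hgx).1 ((hc.2 x hgx).2 hcx)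
  rw [real_inner_comm, inner_direction_nonneg_iff, inner_sub_left, inner_coe_self] at hcx'
  linarith

lemma isLuneThickness_iff : IsLuneThickness g h t ↔ h ≠ g ∧ h ≠ -g ∧ t = π - sdist g h := by
  refine and_congr_right fun hne => and_congr_right fun hne' => ?_
  have hg := orthComponent_ne_zero hne hne'
  have hh : orthComponent h g ≠ 0 :=
    orthComponent_ne_zero hne.symm fun heq => hne' (by rw [heq, neg_neg])
  have hdist : sdist (direction _ hg) (direction _ hh) = π - sdist g h := by
    rw [sdist_direction_direction, angle_orthComponent_orthComponent hne hne']
  refine ⟨?_, fun ht => ⟨_, _, isSemicircleCenter_direction hg, isSemicircleCenter_direction hh,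
    ht.trans hdist.symm⟩⟩
  rintro ⟨c, c', hc, hc', rfl⟩
  rw [← hdist, semicircleCenter_unique hc (isSemicircleCenter_direction hg),
    semicircleCenter_unique hc' (isSemicircleCenter_direction hh)]

lemma IsLuneThickness.nonneg (hlune : IsLuneThickness g h t) : 0 ≤ t := by
  obtain ⟨-, -, c, c', -, -, rfl⟩ := hlune
  exact sdist_nonneg c c'

end Lune

section Dual

variable {C : Set S2} {b c k k' x y : S2} {r w : ℝ}

/-- The dual of `C`: the set of centers of the hemispheres that contain `C`. -/
def dual (C : Set S2) : Set S2 := {k | C ⊆ hemisphere k}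

lemma mem_dual : k ∈ dual C ↔ ∀ x ∈ C, 0 ≤ ⟪(k : E3), x⟫_ℝ :=
  forall₂_congr fun _ _ => mem_hemisphere

lemma subset_dual_dual (C : Set S2) : C ⊆ dual (dual C) := fun x hx =>
  mem_dual.2 fun _ hk => real_inner_comm (x : E3) _ ▸ mem_dual.1 hk x hx

lemma isClosed_dual (C : Set S2) : IsClosed (dual C) := by
  have heq : dual C = {k : S2 | ∀ x ∈ C, 0 ≤ ⟪(k : E3), x⟫_ℝ} := Set.ext fun _ => mem_dual
  simp only [heq, ofPred_forall]
  exact isClosed_biInter fun x _ => isClosed_le continuous_const (by fun_prop)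

lemma supports_iff (hC : IsClosed C) :
    Supports k C ↔ k ∈ dual C ∧ ∃ x ∈ C, ⟪(k : E3), x⟫_ℝ = 0 := by
  refine and_congr_right fun hk => ⟨fun ⟨x, hx, hx'⟩ =>
    ⟨x, hC.frontier_subset hx, mem_frontier_hemisphere.1 hx'⟩, fun ⟨x, hx, hx'⟩ =>
    ⟨x, ?_, mem_frontier_hemisphere.2 hx'⟩⟩
  rw [hC.frontier_eq]
  exact ⟨hx, fun hint => notMem_interior_hemisphere hx' (interior_mono hk hint)⟩

lemma exists_pos_le_inner (hC : IsClosed C) (hpos : ∀ x ∈ C, 0 < ⟪(k : E3), x⟫_ℝ) :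
    ∃ ε > 0, ∀ x ∈ C, ε ≤ ⟪(k : E3), x⟫_ℝ := by
  rcases C.eq_empty_or_nonempty with rfl | hne
  · exact ⟨1, one_pos, by simp⟩
  · obtain ⟨x, hx, hmin⟩ := hC.isCompact.exists_isMinOn hne
      (f := fun x : S2 => ⟪(k : E3), x⟫_ℝ) (by fun_prop)
    exact ⟨_, hpos x hx, hmin⟩

lemma width_nonneg (k : S2) (C : Set S2) : 0 ≤ width k C :=
  Real.sInf_nonneg fun _ ⟨_, _, hlune⟩ => hlune.nonneg

lemma width_le_pi_sub_sdist (hk' : Supports k' C) (hne : k' ≠ k) (hne' : k' ≠ -k) :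
    width k C ≤ π - sdist k k' :=
  csInf_le ⟨0, fun _ ⟨_, _, hlune⟩ => hlune.nonneg⟩
    ⟨k', hk', isLuneThickness_iff.2 ⟨hne, hne', rfl⟩⟩

lemma luneThickness_nonempty_of_width_pos (hpos : 0 < width k C) :
    {t | ∃ k' : S2, Supports k' C ∧ IsLuneThickness k k' t}.Nonempty := by
  rw [nonempty_iff_ne_empty]
  intro hempty
  exact hpos.ne' (by rw [width, hempty, Real.sInf_empty])

lemma exists_supports_of_width_pos (hpos : 0 < width k C) :
    ∃ k', Supports k' C ∧ k' ≠ k ∧ k' ≠ -k := by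
  obtain ⟨_, k', hk', hlune⟩ := luneThickness_nonempty_of_width_pos hpos
  exact ⟨k', hk', hlune.1, hlune.2.1⟩

lemma exists_mem_dual_pi_sub_width_le_sdist (hpos : 0 < width k C) :
    ∃ b ∈ dual C, π - width k C ≤ sdist k b := by
  obtain ⟨k', hk', -⟩ := exists_supports_of_width_pos hpos
  obtain ⟨b, hb, hmax⟩ := exists_farthest_from k (isClosed_dual C) ⟨k', hk'.1⟩
  refine ⟨b, hb, sub_le_comm.1 (le_csInf (luneThickness_nonempty_of_width_pos hpos) ?_)⟩
  rintro _ ⟨k', hk', hlune⟩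
  rw [(isLuneThickness_iff.1 hlune).2.2]
  exact sub_le_sub_left (hmax k' hk'.1) π

lemma thickness_le_width (hk : Supports k C) : thickness C ≤ width k C := by
  refine csInf_le ⟨0, ?_⟩ ⟨k, hk, rfl⟩
  rintro _ ⟨k, -, rfl⟩
  exact width_nonneg k C

lemma exists_supports_of_thickness_pos (hpos : 0 < thickness C) : ∃ k, Supports k C := by
  by_contra! hnone
  simp [thickness, hnone] at hpos

lemma width_eq_thickness
    (hconst : ∀ k k' : S2, Supports k C → Supports k' C → width k C = width k' C)
    (hk : Supports k C) : width k C = thickness C := by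
  have hset : {w | ∃ k' : S2, Supports k' C ∧ w = width k' C} = {width k C} := by
    refine Subset.antisymm ?_ (singleton_subset_iff.2 ⟨k, hk, rfl⟩)
    rintro _ ⟨k', hk', rfl⟩
    exact hconst k' k hk' hk
  rw [thickness, hset, csInf_singleton]

lemma thickness_lt_pi (hpos : 0 < thickness C) : thickness C < π := by
  obtain ⟨k, hk⟩ := exists_supports_of_thickness_pos hpos
  have hle := thickness_le_width hk
  obtain ⟨k', hk', hne, hne'⟩ := exists_supports_of_width_pos (hpos.trans_le hle)
  have hdist : 0 < sdist k k' := (sdist_nonneg k k').lt_of_ne'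
    fun hzero => hne (sdist_eq_zero_iff.1 hzero).symm
  linarith [width_le_pi_sub_sdist hk' hne hne']

/- Rotating `H(-k)` about a point of `C` gives supporting hemispheres that form arbitrarily thin
lunes with `H(k)`. -/
lemma width_eq_zero_of_forall_inner_eq_zero (hC : IsClosed C)
    (hzero : ∀ x ∈ C, ⟪(k : E3), x⟫_ℝ = 0) : width k C = 0 := by
  refine (width_nonneg k C).antisymm' (not_lt.1 fun hwidth => ?_)
  obtain ⟨k', hk', hne, hne'⟩ := exists_supports_of_width_pos hwidth
  obtain ⟨hk'dual, z, hz, hk'z⟩ := (supports_iff hC).1 hk'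
  set n := orthComponent k k' with hn
  have hn0 : 0 < ‖n‖ ^ 2 := pow_pos (norm_pos_iff.2 (orthComponent_ne_zero hne hne')) 2
  have hnk : ⟪n, k⟫_ℝ = 0 := inner_orthComponent_self k k'
  let v (t : ℝ) : E3 := t • n - k
  have hvC (t : ℝ) (x : S2) (hx : x ∈ C) : ⟪v t, x⟫_ℝ = t * ⟪(k' : E3), x⟫_ℝ := by
    rw [inner_sub_left, real_inner_smul_left, hn, inner_orthComponent_left, hzero x hx, mul_zero,
      sub_zero, sub_zero]
  have hvn (t : ℝ) (ht : 0 < t) : 0 < ⟪v t, n⟫_ℝ := by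
    rw [inner_sub_left, real_inner_smul_left, real_inner_self_eq_norm_sq, real_inner_comm, hnk,
      sub_zero]
    positivity
  have hangle (t : ℝ) (ht : 0 < t) : width k C ≤ π - angle (k : E3) (v t) := by
    have hv : v t ≠ 0 := fun h => (hvn t ht).ne' (by rw [h, inner_zero_left])
    have hq : ⟪(direction (v t) hv : E3), n⟫_ℝ ≠ 0 :=
      (inner_direction_eq_zero_iff hv n).not.2 (hvn t ht).ne'
    rw [← sdist_direction_right k hv]
    refine width_le_pi_sub_sdist ((supports_iff hC).2 ⟨mem_dual.2 fun x hx => ?_, z, hz, ?_⟩)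
      (fun h => hq ?_) fun h => hq ?_
    · rw [inner_direction_nonneg_iff, hvC t x hx]
      exact mul_nonneg ht.le (mem_dual.1 hk'dual x hx)
    · rw [inner_direction_eq_zero_iff, hvC t z hz, hk'z, mul_zero]
    · rw [h, real_inner_comm, hnk]
    · rw [h, coe_neg_sphere, inner_neg_left, real_inner_comm, hnk, neg_zero]
  have hk0 : (k : E3) ≠ 0 := ne_zero_of_mem_unit_sphere k
  have hv0 : v 0 = -k := by simp only [v, zero_smul, zero_sub]
  have hcont : ContinuousAt (fun t => π - angle (k : E3) (v t)) 0 :=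
    continuousAt_const.sub ((continuousAt_angle (x := ((k : E3), v 0)) hk0
      (hv0 ▸ neg_ne_zero.2 hk0)).comp (f := fun t => ((k : E3), v t)) (by fun_prop))
  have hlim := hcont.tendsto.mono_left (nhdsWithin_le_nhds (s := Ioi 0))
  rw [hv0, angle_self_neg_of_nonzero hk0, sub_self] at hlim
  exact hwidth.not_ge (ge_of_tendsto hlim (eventually_mem_nhdsWithin.mono hangle))

lemma neg_notMem_dual (hC : IsClosed C) (hpos : 0 < thickness C) (hk : k ∈ dual C) :
    -k ∉ dual C := by
  intro hk'
  have hzero : ∀ x ∈ C, ⟪(k : E3), x⟫_ℝ = 0 := fun x hx =>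
    le_antisymm (by simpa using mem_dual.1 hk' x hx) (mem_dual.1 hk x hx)
  obtain ⟨k₀, hk₀⟩ := exists_supports_of_thickness_pos hpos
  obtain ⟨-, z, hz, -⟩ := (supports_iff hC).1 hk₀
  have hle := thickness_le_width ((supports_iff hC).2 ⟨hk, z, hz, hzero z hz⟩)
  exact (hpos.trans_le hle).ne' (width_eq_zero_of_forall_inner_eq_zero hC hzero)

lemma supports_of_forall_sdist_le (hC : IsClosed C) (hx : x ∈ dual C)
    (hmax : ∀ k ∈ dual C, sdist y k ≤ sdist y x) (hne : x ≠ y) (hne' : x ≠ -y) :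
    Supports x C := by
  -- Otherwise `x` could be pushed away from `y` within the dual of `C`.
  by_contra hsupp
  have hpos : ∀ z ∈ C, 0 < ⟪(x : E3), z⟫_ℝ := fun z hz => (mem_dual.1 hx z hz).lt_of_ne'
    fun hzero => hsupp ((supports_iff hC).2 ⟨hx, z, hz, hzero⟩)
  obtain ⟨ε, hε, hεC⟩ := exists_pos_le_inner hC hpos
  set m := ⟪(x : E3), y⟫_ℝ with hm
  have hm1 : |m| < 1 := by
    have hlt : -m < 1 := by simpa only [coe_neg_sphere, inner_neg_right] using inner_coe_lt_one hne'
    exact abs_lt.2 ⟨neg_lt.1 hlt, inner_coe_lt_one hne⟩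
  let v : E3 := x - ε • (y : E3)
  have hvy : ⟪v, y⟫_ℝ = m - ε := by
    rw [inner_sub_left, real_inner_smul_left, inner_coe_self, mul_one]
  have hvC : ∀ z ∈ C, 0 ≤ ⟪v, z⟫_ℝ := fun z hz => by
    rw [inner_sub_left, real_inner_smul_left, sub_nonneg]
    exact (mul_le_of_le_one_right hε.le (inner_coe_le_one y z)).trans (hεC z hz)
  have hnorm : |1 - ‖v‖| ≤ ε := by
    simpa [v, norm_smul, abs_of_pos hε] using abs_norm_sub_norm_le (x : E3) v
  have hmv : m * ‖v‖ ≤ m - ε := by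
    rcases eq_or_ne v 0 with hv | hv
    · rw [← hvy, hv, norm_zero, mul_zero, inner_zero_left]
    have hdir : direction v hv ∈ dual C :=
      mem_dual.2 fun z hz => (inner_direction_nonneg_iff hv z).2 (hvC z hz)
    have hinner := sdist_le_sdist_iff.1 (hmax _ hdir)
    rwa [real_inner_comm, ← hm, real_inner_comm, inner_direction_left, hvy, inv_mul_eq_div,
      le_div_iff₀ (norm_pos_iff.2 hv)] at hinner
  nlinarith [abs_mul m (1 - ‖v‖), le_abs_self (m * (1 - ‖v‖)),
    mul_le_mul_of_nonneg_left hnorm (abs_nonneg m)]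

lemma sdist_le_pi_sub_thickness (hC : IsClosed C) (hpos : 0 < thickness C) (hk : k ∈ dual C)
    (hk' : k' ∈ dual C) : sdist k k' ≤ π - thickness C := by
  obtain ⟨a, ha, b, hb, hmax⟩ := exists_farthest_pair (isClosed_dual C) ⟨k, hk⟩
  refine (hmax k hk k' hk').trans ?_
  rcases eq_or_ne b a with rfl | hne
  · rw [sdist_self]
    exact sub_nonneg.2 (thickness_lt_pi hpos).le
  have hne' : b ≠ -a := by
    rintro rfl
    exact neg_notMem_dual hC hpos ha hb
  have hsa : Supports a C := supports_of_forall_sdist_le hC ha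
    (fun k hk => by simpa only [sdist_comm b] using hmax k hk b hb) hne.symm
    fun h => hne' (by rw [h, neg_neg])
  have hsb : Supports b C := supports_of_forall_sdist_le hC hb (hmax a ha) hne hne'
  linarith [thickness_le_width hsa, width_le_pi_sub_sdist hsb hne hne']

lemma exists_supports_sdist_eq (hC : IsClosed C) (hc : c ∈ dual C) (hy : y ∈ C) (hne : y ≠ c)
    (hmax : ∀ z ∈ C, sdist c z ≤ sdist c y) :
    ∃ k, Supports k C ∧ sdist c k = π / 2 - sdist c y := by
  have hle : ∀ z ∈ C, ⟪(c : E3), y⟫_ℝ ≤ ⟪(c : E3), z⟫_ℝ := fun z hz =>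
    sdist_le_sdist_iff.1 (hmax z hz)
  have hnonneg : 0 ≤ ⟪(c : E3), y⟫_ℝ := mem_dual.1 hc y hy
  have hacute : sdist c y ≤ π / 2 := sdist_le_pi_div_two_iff.2 hnonneg
  have hv : orthComponent y c ≠ 0 := orthComponent_ne_zero hne.symm fun heq => by
    rw [heq, coe_neg_sphere, inner_neg_left, inner_coe_self] at hnonneg
    linarith
  refine ⟨direction _ hv, (supports_iff hC).2 ⟨mem_dual.2 fun z hz => ?_, y, hy, ?_⟩, ?_⟩
  · rw [inner_direction_nonneg_iff, inner_orthComponent_left, sub_nonneg, real_inner_comm (c : E3)]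
    exact (mul_le_of_le_one_right hnonneg (inner_coe_le_one y z)).trans (hle z hz)
  · rw [inner_direction_eq_zero_iff, inner_orthComponent_self]
  · have hcos : ⟪(c : E3), direction _ hv⟫_ℝ = cos (π / 2 - sdist c y) := by
      rw [real_inner_comm, inner_direction_left, inner_orthComponent_right, sq,
        inv_mul_cancel_left₀ (norm_ne_zero_iff.2 hv), norm_orthComponent, cos_pi_div_two_sub,
        sdist_comm]
    rw [sdist_eq_arccos, hcos, arccos_cos (sub_nonneg.2 hacute)]
    linarith [sdist_nonneg c y, pi_pos]

lemma subset_ball_of_dual_subset_ball (hC : IsClosed C) (hc : c ∈ dual C) (hw : π / 2 ≤ w)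
    (hconst : ∀ k, Supports k C → width k C = w) (hball : dual C ⊆ ball c r) :
    C ⊆ ball c (w + r - π / 2) := by
  rcases C.eq_empty_or_nonempty with rfl | hCne
  · exact empty_subset _
  obtain ⟨y, hy, hmax⟩ := exists_farthest_from c hC hCne
  suffices hcy : sdist c y ≤ w + r - π / 2 from fun z hz => (hmax z hz).trans hcy
  rcases eq_or_ne y c with rfl | hne
  · have hr : sdist y y ≤ r := hball hc
    linarith
  obtain ⟨k, hk, hck⟩ := exists_supports_sdist_eq hC hc hy hne hmax
  obtain ⟨b, hb, hkb⟩ : ∃ b ∈ dual C, π - w ≤ sdist k b := by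
    rw [← hconst k hk]
    exact exists_mem_dual_pi_sub_width_le_sdist (hconst k hk ▸ pi_div_two_pos.trans_le hw)
  have hcb : sdist c b ≤ r := hball hb
  calc sdist c y = π / 2 - sdist k c := by rw [sdist_comm k, hck, sub_sub_cancel]
    _ ≤ π / 2 - (sdist k b - sdist c b) := by linarith [sdist_triangle k c b]
    _ ≤ w + r - π / 2 := by linarith

end Dual

section JungRadius

variable {d : ℝ}

/-- The circumradius of the equilateral spherical triangle of side `d`: the radius in Jung's theorem
for sets of diameter at most `d` on the sphere. Meaningful for `0 ≤ d ≤ 2π/3`; beyond that no such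
triangle exists and `arcsin` returns its cap `π / 2`. -/
noncomputable def jungRadius (d : ℝ) : ℝ := arcsin (2 * √3 / 3 * sin (d / 2))

lemma jungRadius_pi_sub (w : ℝ) : jungRadius (π - w) = arcsin (2 * √3 / 3 * cos (w / 2)) := by
  rw [jungRadius, sub_div, sin_pi_div_two_sub]

lemma cos_jungRadius (d : ℝ) : cos (jungRadius d) = √((1 + 2 * cos d) / 3) := by
  have hcos : cos d = 1 - 2 * sin (d / 2) ^ 2 := by
    rw [← cos_two_mul_eq_one_sub, mul_div_cancel₀ d two_ne_zero]
  rw [jungRadius, cos_arcsin, mul_pow, div_pow, mul_pow, sq_sqrt zero_le_three, hcos]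
  congr 1
  ring

lemma jungRadius_pos (hd : 0 < d) (hdpi : d ≤ π) : 0 < jungRadius d := by
  have hsin : 0 < sin (d / 2) := sin_pos_of_pos_of_lt_pi (by linarith) (by linarith)
  exact arcsin_pos.2 (by positivity)

lemma jungRadius_mem_Icc (hd : 0 ≤ d) (hdpi : d ≤ π) : jungRadius d ∈ Icc 0 π := by
  have hsin : 0 ≤ sin (d / 2) := sin_nonneg_of_nonneg_of_le_pi (by linarith) (by linarith)
  exact ⟨arcsin_nonneg.2 (by positivity),
    (arcsin_le_pi_div_two _).trans (half_le_self pi_pos.le)⟩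

lemma jungRadius_le_self (hd : 0 ≤ d) (hd' : d ≤ π / 2) : jungRadius d ≤ d := by
  have hdpi : d ≤ π := hd'.trans (half_le_self pi_pos.le)
  have hcos : 0 ≤ cos d := cos_nonneg_of_neg_pi_div_two_le_of_le (by linarith) hd'
  rw [← strictAntiOn_cos.le_iff_ge ⟨hd, hdpi⟩ (jungRadius_mem_Icc hd hdpi), cos_jungRadius]
  refine le_sqrt_of_sq_le ?_
  nlinarith [cos_le_one d]

theorem exists_subset_ball_jungRadius {A : Set S2} (hA : IsClosed A) (hne : A.Nonempty)
    (hd : d ≤ π / 2) (hdiam : ∀ x ∈ A, ∀ y ∈ A, sdist x y ≤ d) :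
    ∃ c ∈ dual (dual A), A ⊆ ball c (jungRadius d) := by
  have hd0 : 0 ≤ d := by
    obtain ⟨x, hx⟩ := hne
    exact (sdist_nonneg x x).trans (hdiam x hx x hx)
  have hdpi : d ≤ π := hd.trans (half_le_self pi_pos.le)
  have hcos0 : 0 ≤ cos d := cos_nonneg_of_neg_pi_div_two_le_of_le (by linarith) hd
  have hcos : ∀ x ∈ A, ∀ y ∈ A, cos d ≤ ⟪(x : E3), y⟫_ℝ := fun x hx y hy =>
    (sdist_le_iff ⟨hd0, hdpi⟩).1 (hdiam x hx y hy)
  obtain ⟨h, hh, hnorm, hinner⟩ := exists_mem_convexHull_le_norm_sq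
    (hA.isCompact.image continuous_subtype_val) (hne.image _)
    (forall_mem_image.2 fun x _ => norm_eq_of_mem_sphere x) hcos0
    (forall_mem_image.2 fun x hx => forall_mem_image.2 (hcos x hx))
  rw [forall_mem_image] at hinner
  have hradius : cos (jungRadius d) ≤ ‖h‖ := by
    rw [cos_jungRadius, sqrt_le_left (norm_nonneg h)]
    rw [finrank_euclideanSpace_fin] at hnorm
    push_cast at hnorm
    linarith
  have hpos : 0 < cos (jungRadius d) := by
    rw [cos_jungRadius]
    positivity
  have hh0 : h ≠ 0 := norm_pos_iff.1 (hpos.trans_le hradius)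
  refine ⟨direction h hh0, mem_dual.2 fun k hk => ?_, fun x hx => ?_⟩
  · rw [inner_direction_nonneg_iff, real_inner_comm]
    have hhalf : convexHull ℝ ((↑) '' A) ⊆ {v : E3 | 0 ≤ ⟪(k : E3), v⟫_ℝ} :=
      convexHull_min (image_subset_iff.2 (mem_dual.1 hk)) (convex_halfSpace_ge
        (innerₗ E3 k).isLinear 0)
    exact hhalf hh
  · have hinner' : ‖h‖ ≤ ⟪(direction h hh0 : E3), x⟫_ℝ := by
      rw [inner_direction_left, inv_mul_eq_div, le_div_iff₀ (norm_pos_iff.2 hh0), ← sq]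
      exact hinner hx
    exact (sdist_le_iff (jungRadius_mem_Icc hd0 hdpi)).2 (hradius.trans hinner')

end JungRadius

end SphericalBody

open SphericalBody Real in
theorem mainTheorem11_general {W : Set S2} (hW : IsClosed W)
    (hconst : ∀ k k' : S2, Supports k W → Supports k' W → width k W = width k' W)
    (hwidth : π / 2 ≤ thickness W) :
    ∃ D : Set S2,
      IsDisk D (thickness W + arcsin (2 * √3 / 3 * cos (thickness W / 2)) - π / 2) ∧ W ⊆ D := by
  have hpos : 0 < thickness W := pi_div_two_pos.trans_le hwidth
  have hlt : thickness W < π := thickness_lt_pi hpos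
  obtain ⟨k, hk⟩ := exists_supports_of_thickness_pos hpos
  obtain ⟨c, hc, hball⟩ := exists_subset_ball_jungRadius (isClosed_dual W) ⟨k, hk.1⟩ (by linarith)
    fun k hk k' hk' => sdist_le_pi_sub_thickness hW hpos hk hk'
  have hcW : c ∈ dual W := (subset_dual_dual W).trans hc
  have hradius_pos : 0 < jungRadius (π - thickness W) := jungRadius_pos (by linarith) (by linarith)
  have hradius_le : jungRadius (π - thickness W) ≤ π - thickness W :=
    jungRadius_le_self (by linarith) (by linarith)
  rw [← jungRadius_pi_sub]
  exact ⟨_, ⟨by linarith, by linarith, c, rfl⟩, subset_ball_of_dual_subset_ball hW hcW hwidth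
    (fun _ => width_eq_thickness hconst) hball⟩

theorem mainTheorem11 (W : Set SphericalBody.S2)
    (hW : SphericalBody.IsOfConstantWidth W)
    (hwidth : Real.pi / 2 ≤ SphericalBody.thickness W) :
    ∃ D : Set SphericalBody.S2,
      SphericalBody.IsDisk D
        (SphericalBody.thickness W
          + Real.arcsin (2 * √3 / 3 * Real.cos (SphericalBody.thickness W / 2))
          - Real.pi / 2) ∧
      W ⊆ D :=
  mainTheorem11_general hW.1.1 hW.2 hwidth
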